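/- A *pseudometric space* is a set $X$ with a map $d:X\times X\to\mathbb R$ satisfying $d(x,x)=0$, $d(x,y)=d(y,x)\ge 0$ and $d(x,z)\le d(x,y)+d(y,z)$; it is a *metric space* if moreover $d(x,y)>0$ for $x\ne y$. For a pseudometric space $(X,d)$ define $\underline d:X\to\mathbb R$ as follows: if $X$ has at least three points, then $$\underline d(x)=\inf_{y,z\in X\setminus\{x\},\,y\ne z}\frac{d(x,y)+d(x,z)-d(y,z)}2;$$ if $X=\{x,y\}$ has two points, then $\underline d(x)=\underline d(y)=d(x,y)/2$; if $X$ has one point, then $\underline d=0$. The space $(X,d)$ is *trim* if $\underline d=0$. (A finite metric space is trim if and only if it has at most one point or for every $x\in X$ there are distinct $y,z\in X\setminus\{x\}$ with $d(x,y)+d(x,z)=d(y,z)$.) Let $d^\bullet$ be the pseudometric on $X$ with $d^\bullet(x,x)=0$ and $d^\bullet(x,y)=d(x,y)-\underline d(x)-\underline d(y)$ for $x\ne y$, and let $t(X)$ be the metric quotient of $(X,d^\bullet)$, obtained by identifying points at $d^\bullet$-distance $0$. For every finite pseudometric space $X$ there is an $n\ge 0$ such that $t^n(X)$ is a trim metric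 space (where $t^0(X)=X$); for the least such $n$, the space $c(X)=t^n(X)$ is the *trim core* of $X$. A *tree* is a connected graph without cycles whose edges carry non-negative real lengths; for vertices $u,v$ of a tree $\tau$, $d_\tau(u,v)$ is the sum of the lengths of the edges of the path from $u$ to $v$. A *rooted tree* is a tree with at least one edge and a distinguished vertex $\ast$, the root; its *leaves* are the vertices of degree $1$ distinct from $\ast$, and $\partial\tau$ is the set of leaves. A *metric forest* $\zeta$ consists of a metric space $(B,d_B)$, its *base*, and a family of rooted trees $(\zeta_a,\ast_a)_{a\in B}$; it is *finite* if $B$ is finite and every $\zeta_a$ is finite. Its *leaf space* is the disjoint union $\partial\zeta=\coprod_{a\in B}\partial\zeta_a$ with the pseudometric defined, for $x\in\partial\zeta_a$ and $y\in\partial\zeta_b$, by $d_\zeta(x,y)=d_{\zeta_a}(x,y)$ if $a=b$ and $d_\zeta(x,y)=d_{\zeta_a}(x,\ast_a)+d_B(a,b)+d_{\zeta_b}(y,\ast_b)$ if $a\ne b$. **Theorem.** For every finite metric forest $\zeta$ whose base $B$ is a trim metric space, the trim core $c(\partial\zeta)$ of its leaf space is isometric to $B$; that is, there is a distance-preserving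 bijection $c(\partial\zeta)\to B$. -/

import Mathlib

universe u v

namespace Trimming

section Underline

variable {X : Type u} [PseudoMetricSpace X]

/-- The three-argument map `d(x,y,z) = (d(x,y) + d(x,z) - d(y,z)) / 2` derived from `d`. -/
noncomputable def triple (x y z : X) : ℝ := (dist x y + dist x z - dist y z) / 2

open Classical in
/-- The function `underline d` of a pseudometric space. If the space has at least three points
(that is, if there are two distinct points other than `x`), it is the infimum of `d(x,y,z)` over all
distinct `y, z` in `X \ {x}`. If the space consists of `x` and exactly one other point `y`, it is
`d(x,y) / 2`. If `x` is the only point, it is `0`. -/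
noncomputable def under (x : X) : ℝ :=
  if ∃ y z : X, y ≠ x ∧ z ≠ x ∧ y ≠ z then
    sInf {r : ℝ | ∃ y z : X, y ≠ x ∧ z ≠ x ∧ y ≠ z ∧ r = triple x y z}
  else if h : ∃ y : X, y ≠ x then dist x h.choose / 2
  else 0

lemma triple_nonneg (x y z : X) : 0 ≤ triple x y z := by
  have := dist_triangle y x z
  rw [dist_comm y x] at this
  unfold triple; linarith

lemma under_le {x y z : X} (hy : y ≠ x) (hz : z ≠ x) (hyz : y ≠ z) :
    under x ≤ triple x y z := by
  rw [under, if_pos ⟨y, z, hy, hz, hyz⟩]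
  refine csInf_le ⟨0, ?_⟩ ⟨y, z, hy, hz, hyz, rfl⟩
  rintro r ⟨y, z, _, _, _, rfl⟩
  exact triple_nonneg x y z

lemma le_under {x : X} {c : ℝ} (hX : ∃ y z : X, y ≠ x ∧ z ≠ x ∧ y ≠ z)
    (h : ∀ y z : X, y ≠ x → z ≠ x → y ≠ z → c ≤ triple x y z) : c ≤ under x := by
  rw [under, if_pos hX]
  obtain ⟨y, z, hy, hz, hyz⟩ := hX
  refine le_csInf ⟨_, y, z, hy, hz, hyz, rfl⟩ ?_
  rintro r ⟨y, z, hy, hz, hyz, rfl⟩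
  exact h y z hy hz hyz

lemma under_of_two {x y : X} (hy : y ≠ x) (h : ∀ z : X, z = x ∨ z = y) :
    under x = dist x y / 2 := by
  have h3 : ¬ ∃ y z : X, y ≠ x ∧ z ≠ x ∧ y ≠ z := by
    rintro ⟨a, b, ha, hb, hab⟩
    exact hab (((h a).resolve_left ha).trans ((h b).resolve_left hb).symm)
  have h2 : ∃ y : X, y ≠ x := ⟨y, hy⟩
  rw [under, if_neg h3, dif_pos h2, (h h2.choose).resolve_left h2.choose_spec]

lemma under_of_one {x : X} (h : ∀ z : X, z = x) : under x = 0 := by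
  have h3 : ¬ ∃ y z : X, y ≠ x ∧ z ≠ x ∧ y ≠ z := fun ⟨a, _, ha, _⟩ => ha (h a)
  have h2 : ¬ ∃ y : X, y ≠ x := fun ⟨a, ha⟩ => ha (h a)
  rw [under, if_neg h3, dif_neg h2]

lemma under_cases {X : Type u} (x : X) :
    (∃ y z : X, y ≠ x ∧ z ≠ x ∧ y ≠ z) ∨ (∃ y : X, y ≠ x ∧ ∀ z : X, z = x ∨ z = y) ∨
      ∀ z : X, z = x := by
  by_cases h1 : ∀ z : X, z = x
  · exact Or.inr (Or.inr h1)
  · push Not at h1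
    obtain ⟨y, hy⟩ := h1
    by_cases h2 : ∀ z : X, z = x ∨ z = y
    · exact Or.inr (Or.inl ⟨y, hy, h2⟩)
    · push Not at h2
      obtain ⟨z, hz, hzy⟩ := h2
      exact Or.inl ⟨y, z, hy, hz, hzy.symm⟩

lemma under_nonneg (x : X) : 0 ≤ under x := by
  rcases under_cases x with h | ⟨y, hy, h⟩ | h
  · exact le_under h fun y z _ _ _ => triple_nonneg x y z
  · rw [under_of_two hy h]; positivity
  · rw [under_of_one h]

lemma under_add_under_le {x y : X} (h : x ≠ y) : under x + under y ≤ dist x y := by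
  by_cases h3 : ∃ z : X, z ≠ x ∧ z ≠ y
  · obtain ⟨z, hzx, hzy⟩ := h3
    have h1 := under_le h.symm hzx hzy.symm
    have h2 := under_le h hzy hzx.symm
    unfold triple at h1 h2
    rw [dist_comm y x] at h2
    linarith
  · have h2 : ∀ z : X, z = x ∨ z = y := by
      intro z
      by_contra hz
      push Not at hz
      exact h3 ⟨z, hz.1, hz.2⟩
    rw [under_of_two h.symm h2, under_of_two h fun z => (h2 z).symm, dist_comm y x]
    linarith

lemma under_isometryEquiv {Y : Type v} [PseudoMetricSpace Y] (e : X ≃ᵢ Y) (x : X) :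
    under (e x) = under x := by
  rcases under_cases x with h | ⟨y, hy, h⟩ | h
  · have h' : ∃ y z : Y, y ≠ e x ∧ z ≠ e x ∧ y ≠ z := by
      obtain ⟨y, z, hy, hz, hyz⟩ := h
      exact ⟨e y, e z, e.injective.ne hy, e.injective.ne hz, e.injective.ne hyz⟩
    apply le_antisymm
    · refine le_under h fun y z hy hz hyz => ?_
      have := under_le (e.injective.ne hy) (e.injective.ne hz) (e.injective.ne hyz)
      simpa [triple, e.dist_eq] using this
    · refine le_under h' fun y z hy hz hyz => ?_
      obtain ⟨y, rfl⟩ := e.surjective y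
      obtain ⟨z, rfl⟩ := e.surjective z
      have := under_le (e.injective.ne_iff.1 hy) (e.injective.ne_iff.1 hz)
        (e.injective.ne_iff.1 hyz)
      simpa [triple, e.dist_eq] using this
  · have h' : ∀ z : Y, z = e x ∨ z = e y := by
      intro z
      obtain ⟨z, rfl⟩ := e.surjective z
      exact (h z).imp (congrArg e) (congrArg e)
    rw [under_of_two hy h, under_of_two (e.injective.ne hy) h', e.dist_eq]
  · have h' : ∀ z : Y, z = e x := by
      intro z
      obtain ⟨z, rfl⟩ := e.surjective z
      exact congrArg e (h z)
    rw [under_of_one h, under_of_one h']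

end Underline

/-- A pseudometric space is trim if `underline d = 0`. -/
def IsTrim (X : Type u) [PseudoMetricSpace X] : Prop := ∀ x : X, under x = 0

/-- `x` lies between `y` and `z` (in the sense of Menger). -/
def LiesBetween {X : Type u} [PseudoMetricSpace X] (x y z : X) : Prop :=
  y ≠ x ∧ z ≠ x ∧ y ≠ z ∧ dist x y + dist x z = dist y z

/-- For finite metric spaces, being trim means having at most one point, or every point lying
between two other points. -/
theorem isTrim_iff_liesBetween (X : Type u) [MetricSpace X] [Finite X] :
    IsTrim X ↔ Subsingleton X ∨ ∀ x : X, ∃ y z : X, LiesBetween x y z := by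
  constructor
  · intro h
    by_cases hs : Subsingleton X
    · exact Or.inl hs
    · refine Or.inr fun x => ?_
      rcases under_cases x with h3 | ⟨y, hy, h2⟩ | h1
      · have hx := h x
        rw [under, if_pos h3] at hx
        have hfin : {r : ℝ | ∃ y z : X, y ≠ x ∧ z ≠ x ∧ y ≠ z ∧ r = triple x y z}.Finite := by
          refine (Set.finite_range fun p : X × X => triple x p.1 p.2).subset ?_
          rintro r ⟨y, z, _, _, _, rfl⟩
          exact ⟨(y, z), rfl⟩
        obtain ⟨y, z, hy, hz, hyz⟩ := h3
        have hne : {r : ℝ | ∃ y z : X, y ≠ x ∧ z ≠ x ∧ y ≠ z ∧ r = triple x y z}.Nonempty :=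
          ⟨_, y, z, hy, hz, hyz, rfl⟩
        have hmem := hne.csInf_mem hfin
        rw [hx] at hmem
        obtain ⟨y, z, hy, hz, hyz, h0⟩ := hmem
        refine ⟨y, z, hy, hz, hyz, ?_⟩
        unfold triple at h0
        linarith
      · have hx := h x
        rw [under_of_two hy h2] at hx
        have := dist_pos.2 hy.symm
        linarith
      · exact absurd ⟨fun a b => (h1 a).trans (h1 b).symm⟩ hs
  · rintro (hs | h) x
    · exact under_of_one fun z => Subsingleton.elim z x
    · obtain ⟨y, z, hy, hz, hyz, h0⟩ := h x
      refine le_antisymm ?_ (under_nonneg x)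
      refine (under_le hy hz hyz).trans ?_
      unfold triple
      linarith

/-- The underlying set of `X`, to be equipped with the pseudometric `d•`. -/
def Bullet (X : Type u) : Type u := X

open Classical in
/-- The pseudometric `d•` obtained from `d` by the drift with the function `-underline d`. -/
noncomputable instance (X : Type u) [PseudoMetricSpace X] : PseudoMetricSpace (Bullet X) where
  dist := fun x y : X => if x = y then 0 else dist x y - under x - under y
  dist_self := fun x : X => if_pos rfl
  dist_comm := by
    intro (x : X) (y : X)
    by_cases h : x = y
    · rw [if_pos h, if_pos h.symm]
    · rw [if_neg h, if_neg (Ne.symm h), dist_comm x y]; ring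
  dist_triangle := by
    intro (x : X) (y : X) (z : X)
    by_cases hxy : x = y
    · subst hxy; simp
    by_cases hyz : y = z
    · subst hyz; simp
    rw [if_neg hxy, if_neg hyz]
    have h1 := under_add_under_le hxy
    have h2 := under_add_under_le hyz
    by_cases hxz : x = z
    · rw [if_pos hxz]; linarith
    · rw [if_neg hxz]
      have h3 := under_le hxy (Ne.symm hyz) hxz
      unfold triple at h3
      rw [dist_comm y x] at h3
      linarith

lemma bullet_dist_of_ne {X : Type u} [PseudoMetricSpace X] {x y : X} (h : x ≠ y) :
    dist (α := Bullet X) x y = dist x y - under x - under y := if_neg h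

lemma under_bullet {X : Type u} [PseudoMetricSpace X] (x : Bullet X) : under x = 0 := by
  refine le_antisymm ?_ (under_nonneg x)
  rcases under_cases x with h | ⟨y, hy, h⟩ | h
  · have key : under (X := X) x + under (X := Bullet X) x ≤ under (X := X) x := by
      refine le_under (X := X) h fun y z hy hz hyz => ?_
      have h1 := under_le (X := Bullet X) hy hz hyz
      unfold triple at h1 ⊢
      rw [bullet_dist_of_ne (Ne.symm hy), bullet_dist_of_ne (Ne.symm hz),
        bullet_dist_of_ne hyz] at h1
      linarith
    linarith
  · have h1 := under_of_two (X := X) hy h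
    have h2 := under_of_two (X := X) (Ne.symm hy) fun z => (h z).symm
    have h3 := bullet_dist_of_ne (X := X) (Ne.symm hy)
    have h4 := dist_comm (α := X) y x
    refine (under_of_two hy h).trans_le ?_
    linarith
  · rw [under_of_one h]

/-- A bundled pseudometric space. -/
structure PMSpace : Type (u + 1) where
  carrier : Type u
  [str : PseudoMetricSpace carrier]

instance : CoeSort PMSpace.{u} (Type u) := ⟨PMSpace.carrier⟩

instance (X : PMSpace.{u}) : PseudoMetricSpace X := X.str

/-- The space `t(X)` obtained from `X` by trimming: the metric quotient of `(X, d•)`. The quotient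
`SeparationQuotient` identifies exactly the points at distance zero. -/
noncomputable def trim (X : PMSpace.{u}) : PMSpace.{u} := ⟨SeparationQuotient (Bullet X)⟩

/-- `X` is a trim metric space. -/
def IsTrimMetric (X : PMSpace.{u}) : Prop :=
  (∀ x y : X, dist x y = 0 → x = y) ∧ IsTrim X

/-- `X` has finite height if some iterated trimming `t^n(X)`, `n ≥ 0`, is a trim metric space. -/
def HasFiniteHeight (X : PMSpace.{u}) : Prop := ∃ n : ℕ, IsTrimMetric (trim^[n] X)

/-- Every finite pseudometric space has finite height. -/
theorem hasFiniteHeight (X : PMSpace.{u}) [hX : Finite X] : HasFiniteHeight X := by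
  induction hN : Nat.card X using Nat.strong_induction_on generalizing X with
  | _ N ih =>
    have : Finite (Bullet X) := hX
    have hsurj : Function.Surjective (SeparationQuotient.mk : Bullet X → _) :=
      SeparationQuotient.surjective_mk
    have hfin : Finite (trim X) := Finite.of_surjective _ hsurj
    by_cases hinj : Function.Injective (SeparationQuotient.mk : Bullet X → _)
    · refine ⟨1, ?_, ?_⟩
      · intro (x : SeparationQuotient (Bullet X)) (y : SeparationQuotient (Bullet X)) h
        exact eq_of_dist_eq_zero (γ := SeparationQuotient (Bullet X)) h
      · let e : Bullet X ≃ᵢ SeparationQuotient (Bullet X) :=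
          ⟨Equiv.ofBijective _ ⟨hinj, hsurj⟩,
            Isometry.of_dist_eq fun x y => SeparationQuotient.dist_mk x y⟩
        intro (x : SeparationQuotient (Bullet X))
        obtain ⟨x, rfl⟩ := e.surjective x
        exact (under_isometryEquiv e x).trans (under_bullet x)
    · have hlt : Nat.card (trim X) < N := by
        rw [← hN]
        refine lt_of_le_of_ne
          (Nat.card_le_card_of_surjective _ hsurj) ?_
        intro hc
        exact hinj ((Nat.bijective_iff_surjective_and_card _).2
          ⟨hsurj, hc.symm⟩).1
      obtain ⟨n, hn⟩ := ih _ hlt (trim X) rfl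
      exact ⟨n + 1, hn⟩

open Classical in
/-- The height of a space of finite height: the least `n ≥ 0` such that `t^n(X)` is a trim metric
space. -/
noncomputable def height (X : PMSpace.{u}) (h : HasFiniteHeight X) : ℕ := Nat.find h

/-- The trim core `c(X) = t^n(X)`, `n` the height of `X`, of a finite pseudometric space. -/
noncomputable def trimCore (X : PMSpace.{u}) [Finite X] : PMSpace.{u} :=
  trim^[height X (hasFiniteHeight X)] X

/-- A metric tree with vertex set `V`: a connected graph without cycles whose edges are endowed with
non-negative lengths (values of `length` outside the edges are irrelevant). -/
structure MetricTree (V : Type v) where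
  graph : SimpleGraph V
  isTree : graph.IsTree
  length : Sym2 V → ℝ
  length_nonneg : ∀ e ∈ graph.edgeSet, 0 ≤ length e

namespace MetricTree

variable {V : Type v} (τ : MetricTree V)

/-- The sum of the lengths of the edges traversed by a walk. -/
def walkLength {x y : V} (p : τ.graph.Walk x y) : ℝ := (p.edges.map τ.length).sum

/-- The unique (hence shortest) path between two vertices of a tree. -/
noncomputable def path (x y : V) : τ.graph.Walk x y :=
  (τ.isTree.existsUnique_path x y).choose

lemma path_isPath (x y : V) : (τ.path x y).IsPath :=
  (τ.isTree.existsUnique_path x y).choose_spec.1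

lemma eq_path {x y : V} (p : τ.graph.Walk x y) (hp : p.IsPath) : p = τ.path x y :=
  (τ.isTree.existsUnique_path x y).choose_spec.2 p hp

/-- The path pseudometric on the set of vertices: the sum of the lengths of the edges forming the
path between two vertices. -/
noncomputable def pathDist (x y : V) : ℝ := τ.walkLength (τ.path x y)

lemma walkLength_nonneg {x y : V} (p : τ.graph.Walk x y) : 0 ≤ τ.walkLength p := by
  refine List.sum_nonneg ?_
  intro r hr
  obtain ⟨e, he, rfl⟩ := List.mem_map.1 hr
  exact τ.length_nonneg e (p.edges_subset_edgeSet he)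

lemma pathDist_nonneg (x y : V) : 0 ≤ τ.pathDist x y := τ.walkLength_nonneg _

lemma pathDist_self (x : V) : τ.pathDist x x = 0 := by
  rw [pathDist, ← τ.eq_path SimpleGraph.Walk.nil SimpleGraph.Walk.IsPath.nil]
  simp [walkLength]

lemma pathDist_comm (x y : V) : τ.pathDist x y = τ.pathDist y x := by
  rw [pathDist, ← τ.eq_path _ (τ.path_isPath y x).reverse]
  simp [walkLength, pathDist, List.sum_reverse]

lemma pathDist_le_walkLength {x y : V} (p : τ.graph.Walk x y) :
    τ.pathDist x y ≤ τ.walkLength p := by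
  classical
  rw [pathDist, ← τ.eq_path _ p.bypass_isPath]
  have hnd : p.bypass.edges.Nodup := p.bypass_isPath.isTrail.edges_nodup
  have hsub : p.bypass.edges.Subperm p.edges :=
    List.subperm_of_subset hnd p.edges_bypass_subset_edges
  obtain ⟨l, hl, hls⟩ := hsub
  unfold walkLength
  rw [← (hl.map τ.length).sum_eq]
  refine (hls.map τ.length).sum_le_sum ?_
  intro r hr
  obtain ⟨e, he, rfl⟩ := List.mem_map.1 hr
  exact τ.length_nonneg e (p.edges_subset_edgeSet he)

lemma pathDist_triangle (x y z : V) :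
    τ.pathDist x z ≤ τ.pathDist x y + τ.pathDist y z := by
  refine (τ.pathDist_le_walkLength ((τ.path x y).append (τ.path y z))).trans_eq ?_
  simp [walkLength, pathDist]

end MetricTree

/-- A rooted tree: a metric tree with at least one edge and a distinguished vertex. -/
structure RootedTree (V : Type v) extends MetricTree V where
  root : V
  exists_edge : graph.edgeSet.Nonempty

/-- A leaf of a rooted tree is a vertex distinct from the root and of degree 1, that is, with exactly
one adjacent vertex. -/
def RootedTree.IsLeaf {V : Type v} (τ : RootedTree V) (x : V) : Prop :=
  x ≠ τ.root ∧ ∃! y : V, τ.graph.Adj x y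

/-- A metric forest with base the metric space `B`: a family of rooted trees indexed by `B`. -/
structure MetricForest (B : Type u) [MetricSpace B] where
  vertex : B → Type v
  tree : ∀ a : B, RootedTree (vertex a)

namespace MetricForest

variable {B : Type u} [MetricSpace B] (ζ : MetricForest.{u, v} B)

/-- A metric forest is finite if its base is finite and its components are finite trees (finitely
many vertices, hence finitely many edges). -/
class IsFinite : Prop where
  base : Finite B
  component : ∀ a : B, Finite (ζ.vertex a)

/-- The disjoint union of the sets of leaves of the components. -/
def Leaves : Type (max u v) := Σ a : B, {x : ζ.vertex a // (ζ.tree a).IsLeaf x}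

open Classical in
/-- The distance `d_ζ` between two leaves of a forest. -/
noncomputable def leafDist (x y : ζ.Leaves) : ℝ :=
  if h : x.1 = y.1 then (ζ.tree y.1).pathDist (h ▸ x.2.1) y.2.1
  else (ζ.tree x.1).pathDist x.2.1 (ζ.tree x.1).root + dist x.1 y.1
    + (ζ.tree y.1).pathDist y.2.1 (ζ.tree y.1).root

lemma leafDist_same (a : B) (x y : {x : ζ.vertex a // (ζ.tree a).IsLeaf x}) :
    ζ.leafDist ⟨a, x⟩ ⟨a, y⟩ = (ζ.tree a).pathDist x.1 y.1 := by
  simp [leafDist]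

lemma leafDist_ne {a b : B} (h : a ≠ b) (x : {x : ζ.vertex a // (ζ.tree a).IsLeaf x})
    (y : {x : ζ.vertex b // (ζ.tree b).IsLeaf x}) :
    ζ.leafDist ⟨a, x⟩ ⟨b, y⟩ = (ζ.tree a).pathDist x.1 (ζ.tree a).root + dist a b
      + (ζ.tree b).pathDist y.1 (ζ.tree b).root := by
  simp [leafDist, h]

noncomputable instance : PseudoMetricSpace ζ.Leaves where
  dist := ζ.leafDist
  dist_self := by
    rintro ⟨a, x⟩
    rw [leafDist_same, MetricTree.pathDist_self]
  dist_comm := by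
    rintro ⟨a, x⟩ ⟨b, y⟩
    by_cases h : a = b
    · subst h
      rw [leafDist_same, leafDist_same, MetricTree.pathDist_comm]
    · rw [leafDist_ne ζ h, leafDist_ne ζ (Ne.symm h), dist_comm a b]
      ring
  dist_triangle := by
    rintro ⟨a, x⟩ ⟨b, y⟩ ⟨c, z⟩
    have hx := (ζ.tree a).pathDist_nonneg x.1 (ζ.tree a).root
    have hy := (ζ.tree b).pathDist_nonneg y.1 (ζ.tree b).root
    have hz := (ζ.tree c).pathDist_nonneg z.1 (ζ.tree c).root
    by_cases hab : a = b
    · subst hab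
      by_cases hac : a = c
      · subst hac
        simp only [leafDist_same]
        exact MetricTree.pathDist_triangle _ _ _ _
      · rw [leafDist_same, leafDist_ne ζ hac, leafDist_ne ζ hac]
        have := (ζ.tree a).pathDist_triangle x.1 y.1 (ζ.tree a).root
        linarith
    · by_cases hbc : b = c
      · subst hbc
        rw [leafDist_same, leafDist_ne ζ hab, leafDist_ne ζ hab]
        have := (ζ.tree b).pathDist_triangle z.1 y.1 (ζ.tree b).root
        rw [MetricTree.pathDist_comm _ z.1 y.1] at this
        linarith
      · rw [leafDist_ne ζ hab, leafDist_ne ζ hbc]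
        by_cases hac : a = c
        · subst hac
          rw [leafDist_same]
          have h1 := (ζ.tree a).pathDist_triangle x.1 (ζ.tree a).root z.1
          rw [MetricTree.pathDist_comm _ (ζ.tree a).root z.1] at h1
          have h2 : 0 ≤ dist a b := dist_nonneg
          have h3 : 0 ≤ dist b a := dist_nonneg
          linarith
        · rw [leafDist_ne ζ hac]
          have := dist_triangle a b c
          linarith

/-- The leaf space `∂ζ` of a metric forest. -/
noncomputable def leafSpace : PMSpace.{max u v} := ⟨ζ.Leaves⟩

instance [h : ζ.IsFinite] : Finite ζ.leafSpace := by
  have := h.base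
  have := h.component
  change Finite (Σ a : B, {x : ζ.vertex a // (ζ.tree a).IsLeaf x})
  infer_instance

end MetricForest

end Trimming

universe w

namespace Trimming

/-! ### Medians and the four-point condition in metric trees -/

namespace MetricTree

variable {V : Type v} (τ : MetricTree V)

lemma pathDist_add_of_append {x y z : V} (p : τ.graph.Walk x y) (q : τ.graph.Walk y z)
    (h : (p.append q).IsPath) : τ.pathDist x z = τ.pathDist x y + τ.pathDist y z := by
  rw [pathDist, pathDist, pathDist, ← τ.eq_path _ h, ← τ.eq_path _ h.of_append_left,
    ← τ.eq_path _ h.of_append_right]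
  simp [walkLength]

lemma pathDist_add_of_mem_support {x y m : V} {p : τ.graph.Walk x y} (hp : p.IsPath)
    (hm : m ∈ p.support) : τ.pathDist x y = τ.pathDist x m + τ.pathDist m y := by
  obtain ⟨q, r, rfl⟩ := p.mem_support_iff_exists_append.1 hm
  exact τ.pathDist_add_of_append q r hp

/-- If two paths share only the end of the first one, then their distances add up. -/
lemma pathDist_add_of_inter {x y z m : V} {q : τ.graph.Walk z m} (hq : q.IsPath)
    {p : τ.graph.Walk x y} (hp : p.IsPath) (hm : m ∈ p.support)
    (h : ∀ t ∈ p.support, t ∈ q.support → t = m) :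
    τ.pathDist z y = τ.pathDist z m + τ.pathDist m y := by
  obtain ⟨r, s, rfl⟩ := p.mem_support_iff_exists_append.1 hm
  refine τ.pathDist_add_of_append q s ?_
  have hs := hp.of_append_right.support_nodup
  rw [SimpleGraph.Walk.isPath_def, SimpleGraph.Walk.support_append, List.nodup_append']
  rw [← SimpleGraph.Walk.cons_tail_support, List.nodup_cons] at hs
  refine ⟨hq.support_nodup, hs.2, fun t ht hts => ?_⟩
  have htm := h t (SimpleGraph.Walk.support_subset_support_append_right _ _
    (List.mem_of_mem_tail hts)) ht
  exact hs.1 (htm ▸ hts)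

/-- Every vertex of a tree has a projection onto every path. -/
lemma exists_median (x y z : V) : ∃ m ∈ (τ.path x y).support,
    τ.pathDist z x = τ.pathDist z m + τ.pathDist m x ∧
      τ.pathDist z y = τ.pathDist z m + τ.pathDist m y := by
  classical
  obtain ⟨m, hm, hmq, h⟩ := (τ.path z x).exists_mem_support_forall_mem_support_imp_eq
    (τ.path x y).support.toFinset
    ⟨x, by simp⟩
  simp only [List.mem_toFinset] at hm h
  have hq := (τ.path_isPath z x).takeUntil hmq
  exact ⟨m, hm, τ.pathDist_add_of_mem_support (τ.path_isPath z x) hmq,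
    τ.pathDist_add_of_inter hq (τ.path_isPath x y) hm h⟩

lemma pathDist_four_point (x y z w : V) :
    τ.pathDist x y + τ.pathDist z w ≤
      max (τ.pathDist x z + τ.pathDist y w) (τ.pathDist x w + τ.pathDist y z) := by
  obtain ⟨m, hm, hzx, hzy⟩ := τ.exists_median x y z
  obtain ⟨n, hn, hwx, hwy⟩ := τ.exists_median x y w
  have hxy := τ.pathDist_add_of_mem_support (τ.path_isPath x y) hm
  have hxy' := τ.pathDist_add_of_mem_support (τ.path_isPath x y) hn
  have h1 := τ.pathDist_triangle z m w
  have h2 := τ.pathDist_triangle m n w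
  have e1 := τ.pathDist_comm x z
  have e2 := τ.pathDist_comm y z
  have e3 := τ.pathDist_comm x w
  have e4 := τ.pathDist_comm y w
  have e5 := τ.pathDist_comm x m
  have e6 := τ.pathDist_comm x n
  have e7 := τ.pathDist_comm m n
  have e8 := τ.pathDist_comm n w
  have hp := τ.path_isPath x y
  obtain ⟨q, r, hqr⟩ := (τ.path x y).mem_support_iff_exists_append.1 hm
  rw [hqr] at hn hp
  rcases (SimpleGraph.Walk.mem_support_append_iff _ _).1 hn with hn | hn
  · have h3 := τ.pathDist_add_of_mem_support hp.of_append_left hn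
    exact le_max_of_le_left (by linarith)
  · have h3 := τ.pathDist_add_of_mem_support hp.of_append_right hn
    exact le_max_of_le_right (by linarith)

end MetricTree

lemma RootedTree.exists_isLeaf {V : Type v} [Finite V] (τ : RootedTree V) :
    ∃ x, τ.IsLeaf x := by
  classical
  have := Fintype.ofFinite V
  obtain ⟨e, he⟩ := τ.exists_edge
  induction e with | h a b =>
  have : Nontrivial V := ⟨a, b, τ.graph.ne_of_adj he⟩
  obtain ⟨u, v, huv, hu, hv⟩ := τ.isTree.exists_ne_and_degree_eq_one
  rw [SimpleGraph.degree_eq_one_iff_existsUnique_adj] at hu hv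
  by_cases h : u = τ.root
  · exact ⟨v, fun hv' => huv (h.trans hv'.symm), hv⟩
  · exact ⟨u, h, hu⟩

/-! ### Properties stable under trimming -/

/-- The metric structure of a trim metric space. -/
abbrev IsTrimMetric.metricSpace {X : PMSpace.{u}} (h : IsTrimMetric X) : MetricSpace X :=
  { X.str with eq_of_dist_eq_zero := fun {x y} => h.1 x y }

lemma isTrimMetric_trimCore (X : PMSpace.{u}) [Finite X] : IsTrimMetric (trimCore X) := by
  classical
  exact Nat.find_spec (hasFiniteHeight X)

instance finite_trim (X : PMSpace.{u}) [hX : Finite X] : Finite (trim X) := by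
  have : Finite (Bullet X) := hX
  exact Finite.of_surjective _ (SeparationQuotient.surjective_mk (X := Bullet X))

lemma trimCore_induction {P : PMSpace.{u} → Prop}
    (hP : ∀ (X : PMSpace.{u}) [Finite X], P X → P (trim X))
    (X : PMSpace.{u}) [hX : Finite X] (h : P X) : P (trimCore X) ∧ Finite (trimCore X) := by
  have key : ∀ n : ℕ, P (trim^[n] X) ∧ Finite (trim^[n] X) := by
    intro n
    induction n with
    | zero => exact ⟨h, hX⟩
    | succ n ih =>
      rw [Function.iterate_succ_apply']
      have := ih.2
      exact ⟨hP _ ih.1, inferInstance⟩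
  exact key _

/-- The quotient map onto the trimmed space has a distance-preserving section. -/
lemma exists_section_trim (X : PMSpace.{u}) :
    ∃ s : trim X → Bullet X, (∀ x y, dist (s x) (s y) = dist x y) ∧
      ∀ x : Bullet X, ∃ y, dist (s y) x = 0 := by
  have hs := SeparationQuotient.surjective_mk (X := Bullet X)
  have hinv : ∀ x : trim X, SeparationQuotient.mk (Function.surjInv hs x) = x :=
    Function.surjInv_eq hs
  refine ⟨Function.surjInv hs, fun x y => ?_, fun x => ⟨SeparationQuotient.mk x, ?_⟩⟩
  · conv_rhs => rw [← hinv x, ← hinv y]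
    exact (SeparationQuotient.dist_mk _ _).symm
  · exact (SeparationQuotient.dist_mk _ _).symm.trans (dist_eq_zero.2 (hinv _))

/-! ### Spaces satisfying the four-point condition -/

/-- Gromov's four-point condition. -/
def FourPoint (X : Type u) [PseudoMetricSpace X] : Prop :=
  ∀ x y z w : X, dist x y + dist z w ≤ max (dist x z + dist y w) (dist x w + dist y z)

lemma FourPoint.of_dist_eq {X : Type u} {Y : Type v} [PseudoMetricSpace X] [PseudoMetricSpace Y]
    (h : FourPoint X) (s : Y → X) (hs : ∀ x y, dist (s x) (s y) = dist x y) : FourPoint Y := by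
  intro x y z w
  simpa only [hs] using h (s x) (s y) (s z) (s w)

lemma FourPoint.bullet {X : Type u} [PseudoMetricSpace X] (h : FourPoint X) :
    FourPoint (Bullet X) := by
  intro x y z w
  by_cases hxy : x = y
  · subst hxy
    rw [dist_self, zero_add, add_comm (dist x w), max_eq_left (by rw [add_comm]), dist_comm x z]
    exact dist_triangle _ _ _
  by_cases hzw : z = w
  · subst hzw
    rw [dist_self, add_zero, max_self, dist_comm y z]
    exact dist_triangle _ _ _
  by_cases hxz : x = z
  · subst hxz
    exact le_max_of_le_right (by rw [dist_comm y x, add_comm])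
  by_cases hyw : y = w
  · subst hyw
    exact le_max_of_le_right (by rw [dist_comm z y])
  by_cases hxw : x = w
  · subst hxw
    exact le_max_of_le_left (by rw [dist_comm y x, dist_comm z x, add_comm])
  by_cases hyz : y = z
  · subst hyz
    exact le_max_of_le_left le_rfl
  rw [bullet_dist_of_ne (X := X) hxy, bullet_dist_of_ne (X := X) hzw, bullet_dist_of_ne (X := X) hxz, bullet_dist_of_ne (X := X) hyw,
    bullet_dist_of_ne (X := X) hxw, bullet_dist_of_ne (X := X) hyz]
  rcases le_max_iff.1 (h (x : X) y z w) with h | h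
  · exact le_max_of_le_left (by linarith)
  · exact le_max_of_le_right (by linarith)

lemma FourPoint.subsingleton {X : Type u} [MetricSpace X] [Finite X] (h : FourPoint X)
    (hX : IsTrim X) : Subsingleton X := by
  refine ((isTrim_iff_liesBetween X).1 hX).elim id fun hb => ?_
  by_contra hs
  have : Nonempty X := not_isEmpty_iff.1 fun _ => hs inferInstance
  obtain ⟨⟨x, y⟩, hmax⟩ := Finite.exists_max fun p : X × X => dist p.1 p.2
  obtain ⟨a, b, ha, hb, -, hab⟩ := hb x
  have h1 := hmax (y, a)
  have h2 := hmax (y, b)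
  have h3 := dist_pos.2 ha.symm
  have h4 := dist_pos.2 hb.symm
  simp only at h1 h2
  rcases le_max_iff.1 (h x y a b) with h | h <;> linarith

/-! ### Spaces resembling leaf spaces of forests -/

/-- The map `π` to the base and the height function `h` present `X` as the leaf space of a forest
with base `B`: fibers of `π` are tree-like, and geodesics between distinct fibers pass through the
base. -/
structure IsForestLike {X : Type w} {B : Type u} [PseudoMetricSpace X] [MetricSpace B]
    (π : X → B) (h : X → ℝ) : Prop where
  surjective : Function.Surjective π
  nonneg : ∀ x, 0 ≤ h x
  dist_eq : ∀ x y, π x ≠ π y → dist x y = h x + h y + dist (π x) (π y)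
  dist_le : ∀ x y, dist x y ≤ h x + h y + dist (π x) (π y)
  ultrametric : ∀ x y z, dist x z - h x - h z - dist (π x) (π z) ≤
    max (dist x y - h x - h y - dist (π x) (π y)) (dist y z - h y - h z - dist (π y) (π z))

namespace IsForestLike

variable {X : Type w} {B : Type u} [MetricSpace B]

lemma comp {Y : Type v} [PseudoMetricSpace X] [PseudoMetricSpace Y] {π : X → B} {h : X → ℝ}
    (H : IsForestLike π h) (s : Y → X) (hs : ∀ x y, dist (s x) (s y) = dist x y)
    (hs' : ∀ x, ∃ y, dist (s y) x = 0) : IsForestLike (π ∘ s) (h ∘ s) where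
  surjective b := by
    obtain ⟨x, rfl⟩ := H.surjective b
    obtain ⟨y, hy⟩ := hs' x
    refine ⟨y, by_contra fun hne => ?_⟩
    have h1 := H.dist_eq _ _ hne
    have h2 := H.nonneg (s y)
    have h3 := H.nonneg x
    have h4 := dist_pos.2 hne
    simp only [Function.comp_apply] at h4
    linarith
  nonneg x := H.nonneg _
  dist_eq x y := by simpa only [hs, Function.comp_apply] using H.dist_eq (s x) (s y)
  dist_le x y := by simpa only [hs, Function.comp_apply] using H.dist_le (s x) (s y)
  ultrametric x y z := by simpa only [hs, Function.comp_apply] using H.ultrametric (s x) (s y) (s z)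

lemma under_le_height [PseudoMetricSpace X] {π : X → B} {h : X → ℝ} (H : IsForestLike π h)
    (hB : ∀ b : B, ∃ c c' : B, LiesBetween b c c') (x : X) : under x ≤ h x := by
  obtain ⟨c, c', hc, hc', hcc, hd⟩ := hB (π x)
  obtain ⟨y, rfl⟩ := H.surjective c
  obtain ⟨z, rfl⟩ := H.surjective c'
  refine (under_le (fun e => hc (congrArg π e)) (fun e => hc' (congrArg π e))
    (fun e => hcc (congrArg π e))).trans_eq ?_
  rw [triple, H.dist_eq _ _ hc.symm, H.dist_eq _ _ hc'.symm, H.dist_eq _ _ hcc]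
  linarith

lemma two_mul_under_le [PseudoMetricSpace X] {π : X → B} {h : X → ℝ} (H : IsForestLike π h)
    (hB : ∀ b : B, ∃ c c' : B, LiesBetween b c c') {x y : X} (hxy : x ≠ y) :
    2 * under x ≤ h x + dist x y - h y - dist (π x) (π y) := by
  by_cases hπ : π x = π y
  · obtain ⟨c, -, hc, -⟩ := hB (π x)
    obtain ⟨z, rfl⟩ := H.surjective c
    have h1 := under_le hxy.symm (fun e => hc (congrArg π e)) fun e => hc (hπ ▸ congrArg π e.symm)
    rw [triple, H.dist_eq _ _ hc.symm, H.dist_eq y z (hπ ▸ hc.symm), hπ] at h1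
    rw [hπ, dist_self]
    linarith
  · have h1 := H.under_le_height hB x
    have h2 := H.dist_eq _ _ hπ
    linarith

lemma bullet [PseudoMetricSpace X] {π : X → B} {h : X → ℝ} (H : IsForestLike π h)
    (hB : ∀ b : B, ∃ c c' : B, LiesBetween b c c') :
    IsForestLike (X := Bullet X) π fun x : X => h x - under x where
  surjective := H.surjective
  nonneg x := sub_nonneg.2 (H.under_le_height hB x)
  dist_eq x y hπ := by
    rw [bullet_dist_of_ne (X := X) fun e => hπ (congrArg π e), H.dist_eq _ _ hπ]
    ring
  dist_le x y := by
    by_cases hxy : x = y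
    · subst hxy
      have := H.under_le_height hB x
      rw [dist_self, dist_self]
      linarith
    · have := H.dist_le (x : X) y
      rw [bullet_dist_of_ne (X := X) hxy]
      linarith
  ultrametric x y z := by
    by_cases hxy : x = y
    · subst hxy
      exact le_max_right _ _
    by_cases hyz : y = z
    · subst hyz
      exact le_max_left _ _
    by_cases hxz : x = z
    · subst hxz
      have := H.two_mul_under_le hB hxy
      rw [dist_self, dist_self, bullet_dist_of_ne (X := X) hxy]
      exact le_max_of_le_left (by linarith)
    rw [bullet_dist_of_ne (X := X) hxy, bullet_dist_of_ne (X := X) hyz, bullet_dist_of_ne (X := X) hxz]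
    rcases le_max_iff.1 (H.ultrametric (x : X) y z) with h | h
    · exact le_max_of_le_left (by linarith)
    · exact le_max_of_le_right (by linarith)

lemma exists_height_le [MetricSpace X] {π : X → B} {h : X → ℝ} (H : IsForestLike π h)
    (hX : ∀ x : X, ∃ y z : X, LiesBetween x y z) (x : X) :
    ∃ y ≠ x, 2 * h x ≤ h x + h y + dist (π x) (π y) - dist x y := by
  obtain ⟨y, z, hy, hz, -, hd⟩ := hX x
  have ht := dist_triangle (π y) (π x) (π z)
  rcases le_max_iff.1 (H.ultrametric y x z) with h | h
  · refine ⟨z, hz, ?_⟩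
    rw [dist_comm y x] at h
    linarith
  · refine ⟨y, hy, ?_⟩
    rw [dist_comm x y, dist_comm (π x)]
    rw [dist_comm x y] at hd
    linarith

/-- A finite trim forest-like metric space is its base. -/
lemma exists_isometryEquiv [MetricSpace X] [Finite X] {π : X → B} {h : X → ℝ}
    (H : IsForestLike π h) (hX : ∀ x : X, ∃ y z : X, LiesBetween x y z) :
    Nonempty (X ≃ᵢ B) := by
  have hinj : Function.Injective π := by
    by_contra hinj
    simp only [Function.Injective, not_forall] at hinj
    obtain ⟨x₀, y₀, hπ₀, hne₀⟩ := hinj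
    let S := {p : X × X // π p.1 = π p.2 ∧ p.1 ≠ p.2}
    have : Nonempty S := ⟨⟨(x₀, y₀), hπ₀, hne₀⟩⟩
    obtain ⟨⟨⟨x, y⟩, hπ, hne⟩, hmax⟩ :=
      Finite.exists_max fun p : S => h p.1.1 + h p.1.2 - dist p.1.1 p.1.2
    simp only at hπ hne hmax
    have hxy := H.dist_le x y
    rw [hπ, dist_self] at hxy
    have key : ∀ z, 2 * h z ≤ h x + h y - dist x y := by
      intro z
      obtain ⟨w, hw, hz⟩ := H.exists_height_le hX z
      by_cases hzw : π z = π w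
      · have := hmax ⟨(z, w), hzw, hw.symm⟩
        rw [hzw, dist_self] at hz
        simp only at this
        linarith
      · have := H.dist_eq _ _ hzw
        linarith
    have h1 := key x
    have h2 := key y
    have h3 := dist_pos.2 hne
    linarith
  have hh : ∀ x, h x = 0 := by
    intro x
    obtain ⟨y, hy, hx⟩ := H.exists_height_le hX x
    have h1 := H.dist_eq x y fun e => hy (hinj e.symm)
    have h2 := H.nonneg x
    linarith
  refine ⟨⟨Equiv.ofBijective π ⟨hinj, H.surjective⟩, Isometry.of_dist_eq fun x y => ?_⟩⟩
  by_cases hxy : x = y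
  · subst hxy
    simp
  · have h1 := H.dist_eq x y fun e => hxy (hinj e)
    rw [hh, hh, zero_add, zero_add] at h1
    exact h1.symm

end IsForestLike

/-! ### Leaf spaces -/

namespace MetricForest

variable {B : Type u} [MetricSpace B] (ζ : MetricForest.{u, v} B)

lemma dist_same (a : B) (x y : {x : ζ.vertex a // (ζ.tree a).IsLeaf x}) :
    dist (α := ζ.Leaves) ⟨a, x⟩ ⟨a, y⟩ = (ζ.tree a).pathDist x.1 y.1 :=
  ζ.leafDist_same a x y

lemma dist_ne {a b : B} (h : a ≠ b) (x : {x : ζ.vertex a // (ζ.tree a).IsLeaf x})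
    (y : {x : ζ.vertex b // (ζ.tree b).IsLeaf x}) :
    dist (α := ζ.Leaves) ⟨a, x⟩ ⟨b, y⟩ = (ζ.tree a).pathDist x.1 (ζ.tree a).root + dist a b
      + (ζ.tree b).pathDist y.1 (ζ.tree b).root :=
  ζ.leafDist_ne h x y

lemma surjective_base [h : ζ.IsFinite] :
    Function.Surjective fun x : ζ.Leaves => x.1 := by
  intro a
  have := h.component a
  obtain ⟨x, hx⟩ := (ζ.tree a).exists_isLeaf
  exact ⟨⟨a, x, hx⟩, rfl⟩

lemma fourPoint_leaves [Subsingleton B] : FourPoint ζ.Leaves := by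
  rintro ⟨a, x⟩ ⟨b, y⟩ ⟨c, z⟩ ⟨d, w⟩
  obtain rfl := Subsingleton.elim a b
  obtain rfl := Subsingleton.elim a c
  obtain rfl := Subsingleton.elim a d
  simp only [dist_same]
  exact (ζ.tree a).pathDist_four_point _ _ _ _

lemma isForestLike_leaves [ζ.IsFinite] :
    IsForestLike (fun x : ζ.Leaves => x.1)
      (fun x => (ζ.tree x.1).pathDist x.2.1 (ζ.tree x.1).root) := by
  have hnn : ∀ x : ζ.Leaves, 0 ≤ (ζ.tree x.1).pathDist x.2.1 (ζ.tree x.1).root :=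
    fun x => MetricTree.pathDist_nonneg _ _ _
  have heq : ∀ x y : ζ.Leaves, x.1 ≠ y.1 → dist x y =
      (ζ.tree x.1).pathDist x.2.1 (ζ.tree x.1).root
        + (ζ.tree y.1).pathDist y.2.1 (ζ.tree y.1).root + dist x.1 y.1 := by
    rintro ⟨a, x⟩ ⟨b, y⟩ h
    rw [dist_ne ζ h]
    ring
  have hle : ∀ x y : ζ.Leaves, dist x y ≤
      (ζ.tree x.1).pathDist x.2.1 (ζ.tree x.1).root
        + (ζ.tree y.1).pathDist y.2.1 (ζ.tree y.1).root + dist x.1 y.1 := by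
    intro x y
    by_cases h : x.1 = y.1
    · obtain ⟨a, x⟩ := x
      obtain ⟨b, y⟩ := y
      obtain rfl : a = b := h
      rw [dist_same, dist_self, add_zero, (ζ.tree a).pathDist_comm y.1]
      exact MetricTree.pathDist_triangle _ _ _ _
    · exact (heq x y h).le
  refine ⟨ζ.surjective_base, hnn, heq, hle, fun x y z => ?_⟩
  by_cases hxy : x.1 = y.1
  · by_cases hyz : y.1 = z.1
    · obtain ⟨a, x⟩ := x
      obtain ⟨b, y⟩ := y
      obtain ⟨c, z⟩ := z
      obtain rfl : a = b := hxy
      obtain rfl : a = c := hyz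
      simp only [dist_same, dist_self]
      have e1 := (ζ.tree a).pathDist_comm z.1 y.1
      rcases le_max_iff.1 ((ζ.tree a).pathDist_four_point x.1 z.1 y.1 (ζ.tree a).root) with h | h
      · exact le_max_of_le_left (by linarith)
      · exact le_max_of_le_right (by linarith)
    · have h1 := heq y z hyz
      have h2 := hle x z
      exact le_max_of_le_right (by linarith)
  · have h1 := heq x y hxy
    have h2 := hle x z
    exact le_max_of_le_left (by linarith)

end MetricForest

/-- The trim core of a finite space satisfying the four-point condition has at most one point. -/
lemma subsingleton_trimCore (X : PMSpace.{u}) [Finite X] (h : FourPoint X) :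
    Subsingleton (trimCore X) ∧ (Nonempty (trimCore X) ↔ Nonempty X) := by
  obtain ⟨⟨h1, h2⟩, h3⟩ := trimCore_induction
    (P := fun Y => FourPoint Y ∧ (Nonempty Y ↔ Nonempty X)) (fun Y _ hY => by
      obtain ⟨s, hs, hs'⟩ := exists_section_trim Y
      refine ⟨FourPoint.of_dist_eq (X := Bullet Y) hY.1.bullet s hs, Iff.trans ?_ hY.2⟩
      exact ⟨fun ⟨y⟩ => ⟨s y⟩, fun ⟨x⟩ => ⟨(hs' x).choose⟩⟩) X ⟨h, Iff.rfl⟩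
  have hc := isTrimMetric_trimCore X
  let _ := hc.metricSpace
  exact ⟨FourPoint.subsingleton h1 hc.2, h2⟩

lemma nonempty_trimCore_isometryEquiv {B : Type u} [MetricSpace B]
    (hB : ∀ b : B, ∃ c c' : B, LiesBetween b c c') [Nontrivial B] (X : PMSpace.{w}) [Finite X]
    {π : X → B} {h : X → ℝ} (H : IsForestLike π h) : Nonempty (trimCore X ≃ᵢ B) := by
  obtain ⟨⟨π', h', H'⟩, hfin⟩ := trimCore_induction
    (P := fun Y => ∃ (π' : Y → B) (h' : Y → ℝ), IsForestLike π' h') (fun Y _ hY => by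
      obtain ⟨π', h', H'⟩ := hY
      obtain ⟨s, hs, hs'⟩ := exists_section_trim Y
      exact ⟨_, _, (H'.bullet hB).comp s hs hs'⟩) X ⟨π, h, H⟩
  have hc := isTrimMetric_trimCore X
  let _ := hc.metricSpace
  rcases (isTrim_iff_liesBetween _).1 hc.2 with hs | hb
  · exact absurd H'.surjective.subsingleton (not_subsingleton B)
  · exact IsForestLike.exists_isometryEquiv H' hb

end Trimming

theorem theorem1p3 {B : Type u} [MetricSpace B]
    (ζ : Trimming.MetricForest.{u, v} B) [ζ.IsFinite] (hB : Trimming.IsTrim B) :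
    Nonempty (Trimming.trimCore ζ.leafSpace ≃ᵢ B) := by
  have hfin : Finite B := Trimming.MetricForest.IsFinite.base ζ
  rcases subsingleton_or_nontrivial B with hs | hs
  · obtain ⟨h1, h2⟩ := Trimming.subsingleton_trimCore ζ.leafSpace ζ.fourPoint_leaves
    have h3 : Nonempty (Trimming.trimCore ζ.leafSpace) ↔ Nonempty B :=
      h2.trans ⟨fun ⟨x⟩ => ⟨x.1⟩, fun ⟨b⟩ => ⟨(ζ.surjective_base b).choose⟩⟩
    refine ⟨⟨⟨fun x => (h3.1 ⟨x⟩).some, fun b => (h3.2 ⟨b⟩).some, fun _ => Subsingleton.elim _ _,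
      fun _ => Subsingleton.elim _ _⟩, Isometry.of_dist_eq fun x y => ?_⟩⟩
    rw [Subsingleton.elim x y, dist_self, dist_self]
  · have hb := ((Trimming.isTrim_iff_liesBetween B).1 hB).resolve_left (not_subsingleton B)
    exact Trimming.nonempty_trimCore_isometryEquiv hb ζ.leafSpace ζ.isForestLike_leaves
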